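/- Let $L\ge 2$, let $d_0,\dots,d_L$ be layer widths with $\min_i d_i\ge\min\{d_0,d_L\}$, let $\lambda>0$ and let $M^\natural\in\mathbb{R}^{d_L\times d_0}$. For $\mathbf w=(W_1,\dots,W_L)$ with $W_i\in\mathbb{R}^{d_i\times d_{i-1}}$, regarded as a vector in $\mathbb{R}^N$ with $N=\sum_{i=1}^L d_id_{i-1}$, put $$\mathcal L(\mathbf w)=\|M^\natural-W_LW_{L-1}\cdots W_1\|_F^2+\frac{\lambda}{L}\sum_{i=1}^L\|W_i\|_F^2,$$ and let $\Omega=\arg\min_{\mathbf w\in\mathbb{R}^N}\mathcal L(\mathbf w)$ be the set of global minimizers. Let $q=2/L$, and suppose that none of the $\min\{d_0,d_L\}$ singular values of $M^\natural$ (zeros included) equals $$\Bigl(1-\frac q2\Bigr)\lambda^{\frac1{2-q}}(1-q)^{\frac{q-1}{2-q}},$$ where $0^0=1$ if $L=2$. Then $\Omega$ is nonempty, and there are a matrix $P^*\in\mathbb{R}^{d_L\times d_0}$ and a number $g^*\ge 0$ such that every $\mathbf w^*=(W_1^*,\dots,W_L^*)\in\Omega$ satisfies $W_L^*\cdots W_1^*=P^*$,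 $\|W_i^*\|_F=g^*$ for all $i\in\{1,\dots,L\}$, and $$\operatorname{tr}\bigl(\nabla^2\mathcal L(\mathbf w^*)\bigr)\ \ge\ 2L\,\frac{\|P^*\|_F^2}{(g^*)^2}+\frac{2\lambda}{L}N.$$ If $g^*=0$ (so that $P^*=0$), the quotient $\|P^*\|_F^2/(g^*)^2$ is read as $0$. -/

import Mathlib

-- On matrices, `‖A‖` denotes the Frobenius norm throughout.
open scoped Matrix.Norms.Frobenius

namespace DeepMatrixFactorization

noncomputable section

/-- Index set of the scalar parameters of a depth `L` factorization with layer widths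
`d 0, …, d L`: the entry `(a, b)` of the layer `i`. Counting layers from `0`, the layer `i` is a
`d (i + 1) × d i` matrix. -/
abbrev ParamIndex {L : ℕ} (d : Fin (L + 1) → ℕ) : Type :=
  Σ i : Fin L, Fin (d i.succ) × Fin (d i.castSucc)

/-- The parameter space `ℝ ^ N`. -/
abbrev Params {L : ℕ} (d : Fin (L + 1) → ℕ) : Type :=
  EuclideanSpace ℝ (ParamIndex d)

/-- The total number `N` of scalar parameters. -/
def numParams {L : ℕ} (d : Fin (L + 1) → ℕ) : ℕ :=
  ∑ i : Fin L, d i.succ * d i.castSucc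

/-- `N` is the number of coordinates of the parameter space. -/
theorem card_paramIndex {L : ℕ} (d : Fin (L + 1) → ℕ) :
    Fintype.card (ParamIndex d) = numParams d := by
  simp [numParams]

/-- The layer `i` of a parameter vector, as a matrix. -/
def layer {L : ℕ} {d : Fin (L + 1) → ℕ} (w : Params d) (i : Fin L) :
    Matrix (Fin (d i.succ)) (Fin (d i.castSucc)) ℝ :=
  Matrix.of fun a b => w ⟨i, (a, b)⟩

/-- The product of the first `k` layers, the later layers standing on the left. -/
def partialProduct {L : ℕ} {d : Fin (L + 1) → ℕ} (w : Params d) (k : Fin (L + 1)) :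
    Matrix (Fin (d k)) (Fin (d 0)) ℝ :=
  Fin.induction (motive := fun k => Matrix (Fin (d k)) (Fin (d 0)) ℝ)
    1 (fun i P => layer w i * P) k

/-- The end-to-end product `W_L * ⋯ * W_1` of all layers. -/
def endToEnd {L : ℕ} {d : Fin (L + 1) → ℕ} (w : Params d) :
    Matrix (Fin (d (Fin.last L))) (Fin (d 0)) ℝ :=
  partialProduct w (Fin.last L)

/-- The `ℓ²`-regularized squared-error loss with target `M` and regularization parameter `reg`. -/
def loss {L : ℕ} {d : Fin (L + 1) → ℕ} (M : Matrix (Fin (d (Fin.last L))) (Fin (d 0)) ℝ)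
    (reg : ℝ) (w : Params d) : ℝ :=
  ‖M - endToEnd w‖ ^ 2 + reg / (L : ℝ) * ∑ i : Fin L, ‖layer w i‖ ^ 2

/-- The set of global minimizers of the loss. -/
def minimizers {L : ℕ} {d : Fin (L + 1) → ℕ} (M : Matrix (Fin (d (Fin.last L))) (Fin (d 0)) ℝ)
    (reg : ℝ) : Set (Params d) :=
  {w | ∀ w' : Params d, loss M reg w ≤ loss M reg w'}

/-- The Hessian matrix of second partial derivatives of `f` at `x`. -/
def hessian {ι : Type*} [Fintype ι] [DecidableEq ι] (f : EuclideanSpace ℝ ι → ℝ)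
    (x : EuclideanSpace ℝ ι) : Matrix ι ι ℝ :=
  Matrix.of fun j k =>
    fderiv ℝ (fun y => fderiv ℝ f y (EuclideanSpace.single k 1)) x (EuclideanSpace.single j 1)

/-- The singular value number `i` of a real matrix, in non-increasing order, counted from `0`. -/
def singularValue {m n : ℕ} (A : Matrix (Fin m) (Fin n) ℝ) (i : ℕ) : ℝ :=
  (Matrix.toEuclideanLin A).singularValues i

/-- The critical value `(1 - q/2) λ ^ (1/(2-q)) (1-q) ^ ((q-1)/(2-q))` with `q = 2/L`. For `L = 2`
the last factor is `0 ^ 0 = 1`. -/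
def criticalValue (L : ℕ) (reg : ℝ) : ℝ :=
  let q : ℝ := 2 / (L : ℝ)
  (1 - q / 2) * reg ^ (1 / (2 - q)) * (1 - q) ^ ((q - 1) / (2 - q))

/-- The matrices one of whose `min m n` singular values equals the critical value. -/
def exceptionalSet (L : ℕ) (reg : ℝ) (m n : ℕ) : Set (Matrix (Fin m) (Fin n) ℝ) :=
  ⋃ i : Fin (min m n), {A | singularValue A i = criticalValue L reg}

end

end DeepMatrixFactorization

/-! Write `c = reg / L` and `P = W_L ⋯ W_1`. Stationarity in each layer forces balance at a
minimizer: neighbouring layers share a Gram matrix at their interface. With `G` the Gram matrix at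
the input, this gives `Pᵀ P = G ^ L`, `Pᵀ M = c G + G ^ L` and `Mᵀ M G ^ L = (c G + G ^ L) ^ 2`, so
`G` commutes with `Mᵀ M` (`commute_gram_zero`).

On a joint unit eigenvector, with eigenvalue `s` of `G` and `μ` of `Mᵀ M`, the layers act along a
chain of unit vectors as multiplication by `√s`. Replacing `√s` by `t` along the chain changes the
loss exactly as it changes `(√μ - t ^ L) ^ 2 + reg * t ^ 2` (`SingularChain.loss_perturb`), so `√s`
minimizes this scalar function. The minimizer is unique unless `√μ` is the critical value
(`IsScalarMinimizer.unique`). Hence `P` acts on each eigenspace of `Mᵀ M` as a multiple of `M`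
independent of the minimizer, and so `P` is determined; equality of losses then determines the
common layer norm.

The loss is exactly quadratic in each single layer, so the trace of its Hessian is explicit
(`trace_hessian_loss`); submultiplicativity of the Frobenius norm gives the bound. -/

namespace DeepMatrixFactorization

open Matrix

/-! ### Products of layers, stationarity and Gram matrices at the interfaces. -/

section Layers

section Frobenius

variable {m n : Type*} [Fintype m] [Fintype n]

theorem frobenius_norm_sq (A : Matrix m n ℝ) : ‖A‖ ^ 2 = ∑ i, ∑ j, A i j ^ 2 := by
  rw [frobenius_norm_def, ← Real.sqrt_eq_rpow, Real.sq_sqrt (by positivity)]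
  simp

theorem trace_transpose_mul (A B : Matrix m n ℝ) : (Aᵀ * B).trace = ∑ i, ∑ j, A i j * B i j := by
  rw [Finset.sum_comm]
  simp [Matrix.trace, Matrix.mul_apply]

theorem frobenius_norm_sq_eq_trace (A : Matrix m n ℝ) : ‖A‖ ^ 2 = (Aᵀ * A).trace := by
  rw [frobenius_norm_sq, trace_transpose_mul]
  simp only [sq]

theorem frobenius_norm_add_sq (A B : Matrix m n ℝ) :
    ‖A + B‖ ^ 2 = ‖A‖ ^ 2 + 2 * (Aᵀ * B).trace + ‖B‖ ^ 2 := by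
  simp only [frobenius_norm_sq, trace_transpose_mul, Finset.mul_sum, ← Finset.sum_add_distrib]
  refine Finset.sum_congr rfl fun i _ => Finset.sum_congr rfl fun j _ => ?_
  simp only [Matrix.add_apply]
  ring

theorem frobenius_norm_smul_sq (t : ℝ) (A : Matrix m n ℝ) : ‖t • A‖ ^ 2 = t ^ 2 * ‖A‖ ^ 2 := by
  rw [norm_smul, mul_pow, Real.norm_eq_abs, sq_abs]

end Frobenius

variable {L : ℕ} {d : Fin (L + 1) → ℕ}

/-- The parameter vector with the given layers. -/
noncomputable def ofLayers (V : ∀ i : Fin L, Matrix (Fin (d i.succ)) (Fin (d i.castSucc)) ℝ) :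
    Params d :=
  WithLp.toLp 2 fun x => V x.1 x.2.1 x.2.2

theorem layer_add_ofLayers (w : Params d)
    (V : ∀ i : Fin L, Matrix (Fin (d i.succ)) (Fin (d i.castSucc)) ℝ) (i : Fin L) :
    layer (w + ofLayers V) i = layer w i + V i := by
  ext a b
  simp [layer, ofLayers]

theorem partialProduct_zero (w : Params d) : partialProduct w 0 = 1 := rfl

theorem partialProduct_succ (w : Params d) (i : Fin L) :
    partialProduct w i.succ = layer w i * partialProduct w i.castSucc := rfl

/-- The product of all layers from the layer `k` on, the later layers standing on the left. -/
noncomputable def suffixProduct (w : Params d) (k : Fin (L + 1)) :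
    Matrix (Fin (d (Fin.last L))) (Fin (d k)) ℝ :=
  Fin.reverseInduction (motive := fun k => Matrix (Fin (d (Fin.last L))) (Fin (d k)) ℝ)
    1 (fun i Q => Q * layer w i) k

theorem suffixProduct_last (w : Params d) : suffixProduct w (Fin.last L) = 1 := by
  simp [suffixProduct]

theorem suffixProduct_castSucc (w : Params d) (i : Fin L) :
    suffixProduct w i.castSucc = suffixProduct w i.succ * layer w i := by
  simp [suffixProduct]

theorem suffixProduct_mul_partialProduct (w : Params d) (k : Fin (L + 1)) :
    suffixProduct w k * partialProduct w k = endToEnd w := by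
  induction k using Fin.reverseInduction with
  | last => rw [suffixProduct_last, Matrix.one_mul, endToEnd]
  | cast i ih => rw [suffixProduct_castSucc, Matrix.mul_assoc, ← partialProduct_succ, ih]

theorem suffixProduct_zero (w : Params d) : suffixProduct w 0 = endToEnd w := by
  rw [← suffixProduct_mul_partialProduct w 0, partialProduct_zero, Matrix.mul_one]

theorem partialProduct_congr {w w' : Params d} (k : Fin (L + 1))
    (h : ∀ i : Fin L, i.castSucc < k → layer w i = layer w' i) :
    partialProduct w k = partialProduct w' k := by
  induction k using Fin.induction with
  | zero => rfl
  | succ i ih =>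
    rw [partialProduct_succ, partialProduct_succ, h i Fin.castSucc_lt_succ,
      ih fun j hj => h j (hj.trans Fin.castSucc_lt_succ)]

theorem suffixProduct_congr {w w' : Params d} (k : Fin (L + 1))
    (h : ∀ i : Fin L, k ≤ i.castSucc → layer w i = layer w' i) :
    suffixProduct w k = suffixProduct w' k := by
  induction k using Fin.reverseInduction with
  | last => rw [suffixProduct_last, suffixProduct_last]
  | cast i ih =>
    rw [suffixProduct_castSucc, suffixProduct_castSucc, h i le_rfl,
      ih fun j hj => h j (Fin.castSucc_lt_succ.le.trans hj)]

/-- The matrix `Wᵀ ⋯ Wᵀ (M - W_L ⋯ W_1) Wᵀ ⋯ Wᵀ` at the interface `k` between two layers. -/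
noncomputable def interfaceResidual (M : Matrix (Fin (d (Fin.last L))) (Fin (d 0)) ℝ)
    (w : Params d) (k : Fin (L + 1)) : Matrix (Fin (d k)) (Fin (d k)) ℝ :=
  (suffixProduct w k)ᵀ * (M - endToEnd w) * (partialProduct w k)ᵀ

theorem endToEnd_add_single (w : Params d) (i : Fin L)
    (X : Matrix (Fin (d i.succ)) (Fin (d i.castSucc)) ℝ) :
    endToEnd (w + ofLayers (Pi.single i X)) =
      endToEnd w + suffixProduct w i.succ * X * partialProduct w i.castSucc := by
  have hne : ∀ j, j ≠ i → layer (w + ofLayers (Pi.single i X)) j = layer w j := by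
    intro j hj
    rw [layer_add_ofLayers, Pi.single_eq_of_ne hj, add_zero]
  rw [← suffixProduct_mul_partialProduct (w + _) i.succ,
    ← suffixProduct_mul_partialProduct w i.succ,
    suffixProduct_congr (w' := w) i.succ, partialProduct_succ, partialProduct_succ,
    partialProduct_congr (w' := w) i.castSucc, layer_add_ofLayers, Pi.single_eq_same]
  · simp only [Matrix.add_mul, Matrix.mul_add, Matrix.mul_assoc]
  · intro j hj
    exact hne j (by rintro rfl; exact lt_irrefl _ hj)
  · intro j hj
    exact hne j (by rintro rfl; exact absurd hj (not_le.2 Fin.castSucc_lt_succ))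

/-- The end-to-end product is affine in each layer, so the expansion stops at second order. The
linear term yields stationarity, the quadratic term the diagonal of the Hessian. -/
theorem loss_add_single (M : Matrix (Fin (d (Fin.last L))) (Fin (d 0)) ℝ) (reg : ℝ)
    (w : Params d) (i : Fin L) (X : Matrix (Fin (d i.succ)) (Fin (d i.castSucc)) ℝ) :
    loss M reg (w + ofLayers (Pi.single i X)) = loss M reg w +
      2 * (reg / L * ((layer w i)ᵀ * X).trace -
        (((suffixProduct w i.succ)ᵀ * (M - endToEnd w) *
          (partialProduct w i.castSucc)ᵀ)ᵀ * X).trace) +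
      (‖suffixProduct w i.succ * X * partialProduct w i.castSucc‖ ^ 2 + reg / L * ‖X‖ ^ 2) := by
  have h1 : ∑ j, ‖layer (w + ofLayers (Pi.single i X)) j‖ ^ 2 =
      ∑ j, ‖layer w j‖ ^ 2 + (2 * ((layer w i)ᵀ * X).trace + ‖X‖ ^ 2) := by
    rw [← Finset.sum_erase_add _ _ (Finset.mem_univ i),
      ← Finset.sum_erase_add _ (fun j => ‖layer w j‖ ^ 2) (Finset.mem_univ i),
      layer_add_ofLayers, Pi.single_eq_same, frobenius_norm_add_sq]
    rw [Finset.sum_congr rfl (g := fun j => ‖layer w j‖ ^ 2)]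
    · ring
    · intro j hj
      rw [layer_add_ofLayers, Pi.single_eq_of_ne (Finset.ne_of_mem_erase hj), add_zero]
  have h2 : ‖M - endToEnd (w + ofLayers (Pi.single i X))‖ ^ 2 = ‖M - endToEnd w‖ ^ 2 -
      2 * (((suffixProduct w i.succ)ᵀ * (M - endToEnd w) *
          (partialProduct w i.castSucc)ᵀ)ᵀ * X).trace +
      ‖suffixProduct w i.succ * X * partialProduct w i.castSucc‖ ^ 2 := by
    rw [endToEnd_add_single, ← sub_sub, sub_eq_add_neg (M - _), frobenius_norm_add_sq, norm_neg]
    simp only [Matrix.mul_neg, Matrix.trace_neg, Matrix.transpose_mul, Matrix.transpose_transpose]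
    rw [← Matrix.mul_assoc _ _ (partialProduct w i.castSucc), Matrix.trace_mul_comm _
      (partialProduct w i.castSucc)]
    simp only [Matrix.mul_assoc]
    ring
  rw [loss, h1, h2, loss]
  ring

theorem eq_zero_of_forall_quadratic_nonneg {b a : ℝ} (h : ∀ t : ℝ, 0 ≤ t * b + t ^ 2 * a) :
    b = 0 := by
  by_contra hb
  have ha : 0 < |a| + 1 := by positivity
  -- The step is short enough for the linear term to outweigh the quadratic one, whatever the sign
  -- of `a`.
  have := h (-b / (|a| + 1))
  have h2 : -b / (|a| + 1) * b + (-b / (|a| + 1)) ^ 2 * a =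
      b ^ 2 * (a - (|a| + 1)) / (|a| + 1) ^ 2 := by
    field_simp
    ring
  rw [h2] at this
  have h3 : b ^ 2 * (a - (|a| + 1)) / (|a| + 1) ^ 2 < 0 := by
    apply div_neg_of_neg_of_pos _ (by positivity)
    apply mul_neg_of_pos_of_neg (by positivity)
    linarith [le_abs_self a]
  linarith

variable {M : Matrix (Fin (d (Fin.last L))) (Fin (d 0)) ℝ} {reg : ℝ} {w : Params d}

theorem stationary_of_mem_minimizers (hw : w ∈ minimizers M reg) (i : Fin L) :
    (suffixProduct w i.succ)ᵀ * (M - endToEnd w) * (partialProduct w i.castSucc)ᵀ =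
      (reg / L) • layer w i := by
  set G := (suffixProduct w i.succ)ᵀ * (M - endToEnd w) * (partialProduct w i.castSucc)ᵀ with hG
  -- Testing in the direction of the partial gradient itself (up to a factor 2) turns its vanishing
  -- derivative into `‖X‖ ^ 2 = 0`.
  set X := (reg / L) • layer w i - G with hX
  have h0 : 2 * (reg / L * ((layer w i)ᵀ * X).trace - (Gᵀ * X).trace) = 0 := by
    refine eq_zero_of_forall_quadratic_nonneg (a := ‖suffixProduct w i.succ * X *
      partialProduct w i.castSucc‖ ^ 2 + reg / L * ‖X‖ ^ 2) fun t => ?_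
    have := hw (w + ofLayers (Pi.single i (t • X)))
    rw [loss_add_single, ← hG] at this
    simp only [Matrix.mul_smul, Matrix.smul_mul, Matrix.trace_smul, frobenius_norm_smul_sq,
      smul_eq_mul] at this
    linarith
  have h1 : ‖X‖ ^ 2 = 0 := by
    rw [frobenius_norm_sq_eq_trace]
    nth_rewrite 1 [hX]
    rw [Matrix.transpose_sub, Matrix.sub_mul, Matrix.trace_sub, Matrix.transpose_smul,
      Matrix.smul_mul, Matrix.trace_smul, smul_eq_mul]
    linarith
  have h2 : X = 0 := by simpa using h1
  exact (sub_eq_zero.1 h2).symm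

/-- The residual at an interface sees only the interface, so this lemma and
`interfaceResidual_succ`, applied to the two adjacent layers, together express balance. -/
theorem interfaceResidual_castSucc (hw : w ∈ minimizers M reg) (i : Fin L) :
    interfaceResidual M w i.castSucc = (reg / L) • ((layer w i)ᵀ * layer w i) := by
  rw [← Matrix.mul_smul, ← stationary_of_mem_minimizers hw, interfaceResidual,
    suffixProduct_castSucc, Matrix.transpose_mul]
  simp only [Matrix.mul_assoc]

theorem interfaceResidual_succ (hw : w ∈ minimizers M reg) (i : Fin L) :
    interfaceResidual M w i.succ = (reg / L) • (layer w i * (layer w i)ᵀ) := by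
  rw [← Matrix.smul_mul, ← stationary_of_mem_minimizers hw, interfaceResidual,
    partialProduct_succ, Matrix.transpose_mul]
  simp only [Matrix.mul_assoc]

/-- At a minimizer, the common value of `Wᵀ W` for the layer after and of `W Wᵀ` for the layer
before the interface `k`. -/
noncomputable def gram (M : Matrix (Fin (d (Fin.last L))) (Fin (d 0)) ℝ) (reg : ℝ)
    (w : Params d) (k : Fin (L + 1)) : Matrix (Fin (d k)) (Fin (d k)) ℝ :=
  (reg / L)⁻¹ • interfaceResidual M w k

theorem gram_castSucc (hc : reg / L ≠ 0) (hw : w ∈ minimizers M reg) (i : Fin L) :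
    gram M reg w i.castSucc = (layer w i)ᵀ * layer w i := by
  rw [gram, interfaceResidual_castSucc hw, inv_smul_smul₀ hc]

theorem gram_succ (hc : reg / L ≠ 0) (hw : w ∈ minimizers M reg) (i : Fin L) :
    gram M reg w i.succ = layer w i * (layer w i)ᵀ := by
  rw [gram, interfaceResidual_succ hw, inv_smul_smul₀ hc]

end Layers

/-! ### Balanced layers, commutation with the target, and perturbation along chains. -/

section Balance

/-- A positive semidefinite matrix is a continuous function of its `k`-th power, namely its `k`-th
root. -/
theorem commute_of_commute_pow {n : Type*} [Fintype n] [DecidableEq n] {A B : Matrix n n ℝ}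
    (hB : B.PosSemidef) {k : ℕ} (hk : k ≠ 0) (h : Commute A (B ^ k)) : Commute A B := by
  have hsa : IsSelfAdjoint B := hB.isHermitian
  have h1 : cfc (fun x : ℝ => x ^ ((k : ℝ)⁻¹)) (B ^ k) = B := by
    rw [← cfc_comp_pow (fun x : ℝ => x ^ ((k : ℝ)⁻¹)) k B
      ((Real.continuous_rpow_const (by positivity)).continuousOn)]
    conv_rhs => rw [← cfc_id ℝ B]
    refine cfc_congr fun x hx => ?_
    have hx0 : 0 ≤ x := (posSemidef_iff_isHermitian_and_spectrum_nonneg.1 hB).2 hx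
    exact Real.pow_rpow_inv_natCast hx0 hk
  rw [← h1]
  exact (h.symm.cfc_real _).symm

variable {L : ℕ} {d : Fin (L + 1) → ℕ}
variable {M : Matrix (Fin (d (Fin.last L))) (Fin (d 0)) ℝ} {reg : ℝ} {w : Params d}

theorem smul_gram (hc : reg / L ≠ 0) (k : Fin (L + 1)) :
    (reg / L) • gram M reg w k = interfaceResidual M w k := by
  rw [gram, smul_inv_smul₀ hc]

theorem exists_gram_zero_eq (hL : L ≠ 0) (hc : reg / L ≠ 0) (hw : w ∈ minimizers M reg) :
    ∃ (m : ℕ) (A : Matrix (Fin m) (Fin (d 0)) ℝ), gram M reg w 0 = Aᵀ * A := by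
  obtain ⟨n, rfl⟩ := Nat.exists_eq_succ_of_ne_zero hL
  exact ⟨_, _, gram_castSucc hc hw 0⟩

theorem gram_zero_posSemidef (hL : L ≠ 0) (hc : reg / L ≠ 0) (hw : w ∈ minimizers M reg) :
    (gram M reg w 0).PosSemidef := by
  obtain ⟨m, A, hA⟩ := exists_gram_zero_eq hL hc hw
  rw [hA, ← conjTranspose_eq_transpose_of_trivial]
  exact posSemidef_conjTranspose_mul_self A

theorem transpose_gram_zero (hL : L ≠ 0) (hc : reg / L ≠ 0) (hw : w ∈ minimizers M reg) :
    (gram M reg w 0)ᵀ = gram M reg w 0 := by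
  obtain ⟨m, A, hA⟩ := exists_gram_zero_eq hL hc hw
  rw [hA, transpose_mul, transpose_transpose]

theorem layer_mul_gram (hc : reg / L ≠ 0) (hw : w ∈ minimizers M reg) (i : Fin L) :
    layer w i * gram M reg w i.castSucc = gram M reg w i.succ * layer w i := by
  rw [gram_castSucc hc hw, gram_succ hc hw, Matrix.mul_assoc]

theorem partialProduct_mul_gram_zero (hc : reg / L ≠ 0) (hw : w ∈ minimizers M reg)
    (k : Fin (L + 1)) :
    partialProduct w k * gram M reg w 0 = gram M reg w k * partialProduct w k := by
  induction k using Fin.induction with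
  | zero => rw [partialProduct_zero, Matrix.one_mul, Matrix.mul_one]
  | succ i ih =>
    rw [partialProduct_succ, Matrix.mul_assoc, ih, ← Matrix.mul_assoc, layer_mul_gram hc hw,
      Matrix.mul_assoc]

/-- Balance turns the innermost `Wᵀ W` into a Gram matrix, which is then moved through the partial
product to the input side. -/
theorem transpose_partialProduct_mul_self (hc : reg / L ≠ 0) (hw : w ∈ minimizers M reg)
    (k : Fin (L + 1)) :
    (partialProduct w k)ᵀ * partialProduct w k = gram M reg w 0 ^ (k : ℕ) := by
  induction k using Fin.induction with
  | zero => simp [partialProduct_zero]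
  | succ i ih =>
    rw [partialProduct_succ, transpose_mul, Matrix.mul_assoc,
      ← Matrix.mul_assoc (layer w i)ᵀ, ← gram_castSucc hc hw, ← partialProduct_mul_gram_zero hc hw,
      ← Matrix.mul_assoc, ih, Fin.val_castSucc, Fin.val_succ, pow_succ]

theorem transpose_endToEnd_mul_self (hc : reg / L ≠ 0) (hw : w ∈ minimizers M reg) :
    (endToEnd w)ᵀ * endToEnd w = gram M reg w 0 ^ L :=
  transpose_partialProduct_mul_self hc hw (Fin.last L)

theorem transpose_endToEnd_mul_target (hc : reg / L ≠ 0) (hw : w ∈ minimizers M reg) :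
    (endToEnd w)ᵀ * M = (reg / L) • gram M reg w 0 + gram M reg w 0 ^ L := by
  rw [smul_gram hc, ← transpose_endToEnd_mul_self hc hw, interfaceResidual, suffixProduct_zero,
    partialProduct_zero, transpose_one, Matrix.mul_one, Matrix.mul_sub, sub_add_cancel]

theorem smul_gram_last (hc : reg / L ≠ 0) :
    (reg / L) • gram M reg w (Fin.last L) = (M - endToEnd w) * (endToEnd w)ᵀ := by
  rw [smul_gram hc, interfaceResidual, suffixProduct_last, transpose_one, Matrix.one_mul, endToEnd]

theorem target_mul_gram_pow (hc : reg / L ≠ 0) (hw : w ∈ minimizers M reg) :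
    M * gram M reg w 0 ^ L =
      endToEnd w * ((reg / L) • gram M reg w 0 + gram M reg w 0 ^ L) := by
  have h : (M - endToEnd w) * gram M reg w 0 ^ L = (reg / L) • (endToEnd w * gram M reg w 0) := by
    rw [← transpose_endToEnd_mul_self hc hw, ← Matrix.mul_assoc, ← smul_gram_last hc,
      Matrix.smul_mul]
    congr 1
    exact (partialProduct_mul_gram_zero hc hw (Fin.last L)).symm
  rw [Matrix.sub_mul, sub_eq_iff_eq_add] at h
  rw [h, Matrix.mul_add, Matrix.mul_smul]

theorem target_gram_mul_gram_pow (hL : L ≠ 0) (hc : reg / L ≠ 0) (hw : w ∈ minimizers M reg) :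
    Mᵀ * M * gram M reg w 0 ^ L = ((reg / L) • gram M reg w 0 + gram M reg w 0 ^ L) *
      ((reg / L) • gram M reg w 0 + gram M reg w 0 ^ L) := by
  rw [Matrix.mul_assoc, target_mul_gram_pow hc hw, ← Matrix.mul_assoc,
    ← transpose_transpose (Mᵀ * endToEnd w), transpose_mul, transpose_transpose,
    transpose_endToEnd_mul_target hc hw, transpose_add, transpose_smul, transpose_pow,
    transpose_gram_zero hL hc hw]

/-- By `target_gram_mul_gram_pow`, the product of the symmetric matrices `Mᵀ * M` and `G ^ L` is
itself symmetric, hence they commute; the `L`-th root inherits this. -/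
theorem commute_gram_zero (hL : L ≠ 0) (hc : reg / L ≠ 0) (hw : w ∈ minimizers M reg) :
    Commute (Mᵀ * M) (gram M reg w 0) := by
  refine commute_of_commute_pow (gram_zero_posSemidef hL hc hw) hL ?_
  have h1 := target_gram_mul_gram_pow hL hc hw
  have h2 := congrArg transpose h1
  simp only [transpose_mul, transpose_transpose, transpose_add, transpose_smul, transpose_pow,
    transpose_gram_zero hL hc hw] at h2
  exact h1.trans h2.symm

theorem norm_layer_sq (hc : reg / L ≠ 0) (hw : w ∈ minimizers M reg) (i : Fin L) :
    ‖layer w i‖ ^ 2 = (gram M reg w 0).trace := by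
  have h : ∀ k : Fin (L + 1), (gram M reg w k).trace = (gram M reg w 0).trace := by
    intro k
    induction k using Fin.induction with
    | zero => rfl
    | succ j ih =>
      rw [← ih, gram_castSucc hc hw, gram_succ hc hw, Matrix.trace_mul_comm]
  rw [frobenius_norm_sq_eq_trace, ← gram_castSucc hc hw, h]

theorem rank_gram (hc : reg / L ≠ 0) (hw : w ∈ minimizers M reg) (k : Fin (L + 1)) :
    (gram M reg w k).rank = (gram M reg w 0).rank := by
  induction k using Fin.induction with
  | zero => rfl
  | succ j ih =>
    rw [← ih, gram_castSucc hc hw, gram_succ hc hw, rank_transpose_mul_self,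
      rank_self_mul_transpose]

/-- A chain of unit vectors, one at each interface between layers, such that each layer acts on the
chain as multiplication by `p`. -/
structure SingularChain (w : Params d) (p : ℝ) (v : ∀ k : Fin (L + 1), Fin (d k) → ℝ) : Prop where
  unit : ∀ k, v k ⬝ᵥ v k = 1
  mulVec : ∀ i : Fin L, layer w i *ᵥ v i.castSucc = p • v i.succ
  transpose_mulVec : ∀ i : Fin L, (layer w i)ᵀ *ᵥ v i.succ = p • v i.castSucc

namespace SingularChain

variable {p : ℝ} {v : ∀ k : Fin (L + 1), Fin (d k) → ℝ}

theorem partialProduct_mulVec (h : SingularChain w p v) (k : Fin (L + 1)) :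
    partialProduct w k *ᵥ v 0 = p ^ (k : ℕ) • v k := by
  induction k using Fin.induction with
  | zero => simp [partialProduct_zero]
  | succ i ih =>
    rw [partialProduct_succ, ← mulVec_mulVec, ih, mulVec_smul, h.mulVec, smul_smul,
      Fin.val_castSucc, Fin.val_succ, pow_succ]

theorem transpose_partialProduct_mulVec (h : SingularChain w p v) (k : Fin (L + 1)) :
    (partialProduct w k)ᵀ *ᵥ v k = p ^ (k : ℕ) • v 0 := by
  induction k using Fin.induction with
  | zero => simp [partialProduct_zero]
  | succ i ih =>
    rw [partialProduct_succ, transpose_mul, ← mulVec_mulVec, h.transpose_mulVec, mulVec_smul, ih,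
      smul_smul, Fin.val_castSucc, Fin.val_succ, pow_succ']

/-- The perturbation replaces the factor `p` by `t` on the chain and leaves the action on its
orthogonal complement unchanged. -/
theorem partialProduct_perturb (h : SingularChain w p v) (t : ℝ) (k : Fin (L + 1)) :
    partialProduct (w + ofLayers fun i => (t - p) • vecMulVec (v i.succ) (v i.castSucc)) k =
      partialProduct w k + (t ^ (k : ℕ) - p ^ (k : ℕ)) • vecMulVec (v k) (v 0) := by
  induction k using Fin.induction with
  | zero => simp [partialProduct_zero]
  | succ i ih =>
    have h1 : v i.castSucc ᵥ* partialProduct w i.castSucc = p ^ (i : ℕ) • v 0 := by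
      rw [← mulVec_transpose, h.transpose_partialProduct_mulVec, Fin.val_castSucc]
    have h2 : layer w i * vecMulVec (v i.castSucc) (v 0) = p • vecMulVec (v i.succ) (v 0) := by
      rw [mul_vecMulVec, h.mulVec, smul_vecMulVec]
    have h3 : vecMulVec (v i.succ) (v i.castSucc) * partialProduct w i.castSucc =
        p ^ (i : ℕ) • vecMulVec (v i.succ) (v 0) := by
      rw [vecMulVec_mul, h1, vecMulVec_smul]
    have h4 : vecMulVec (v i.succ) (v i.castSucc) * vecMulVec (v i.castSucc) (v 0) =
        vecMulVec (v i.succ) (v 0) := by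
      rw [mul_vecMulVec, vecMulVec_mulVec, h.unit]
      simp
    rw [partialProduct_succ, partialProduct_succ, ih, layer_add_ofLayers, Matrix.add_mul,
      Matrix.mul_add, Matrix.mul_add, Matrix.smul_mul, Matrix.smul_mul, Matrix.mul_smul,
      Matrix.mul_smul, h2, h3, h4, Fin.val_castSucc, Fin.val_succ]
    module

/-- Each of the `L` layers contributes `t ^ 2 - p ^ 2` to the regularizer, which cancels the `L` in
`reg / L`. -/
theorem loss_perturb (h : SingularChain w p v) {m : ℝ} (hL : L ≠ 0)
    (hm : v (Fin.last L) ⬝ᵥ M *ᵥ v 0 = m) (t : ℝ) :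
    loss M reg (w + ofLayers fun i => (t - p) • vecMulVec (v i.succ) (v i.castSucc)) =
      loss M reg w + (((m - t ^ L) ^ 2 + reg * t ^ 2) - ((m - p ^ L) ^ 2 + reg * p ^ 2)) := by
  have htr : ∀ {a b : ℕ} (A : Matrix (Fin a) (Fin b) ℝ) (x : Fin a → ℝ) (y : Fin b → ℝ),
      (Aᵀ * vecMulVec x y).trace = x ⬝ᵥ A *ᵥ y := by
    intro a b A x y
    rw [mul_vecMulVec, trace_vecMulVec, mulVec_transpose, ← dotProduct_mulVec]
  have hsq : ∀ {a b : ℕ} (x : Fin a → ℝ) (y : Fin b → ℝ), x ⬝ᵥ x = 1 → y ⬝ᵥ y = 1 →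
      ‖vecMulVec x y‖ ^ 2 = 1 := by
    intro a b x y hx hy
    rw [frobenius_norm_sq_eq_trace, htr, vecMulVec_mulVec]
    simp [hx, hy]
  have hlayer : ∀ i, ‖layer (w + ofLayers fun i =>
      (t - p) • vecMulVec (v i.succ) (v i.castSucc)) i‖ ^ 2 =
      ‖layer w i‖ ^ 2 + (t ^ 2 - p ^ 2) := by
    intro i
    rw [layer_add_ofLayers, frobenius_norm_add_sq, frobenius_norm_smul_sq, hsq _ _ (h.unit _)
      (h.unit _), Matrix.mul_smul, trace_smul, htr, h.mulVec, dotProduct_smul, h.unit]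
    simp only [smul_eq_mul]
    ring
  have hend : ‖M - endToEnd (w + ofLayers fun i =>
      (t - p) • vecMulVec (v i.succ) (v i.castSucc))‖ ^ 2 =
      ‖M - endToEnd w‖ ^ 2 - 2 * (t ^ L - p ^ L) * (m - p ^ L) + (t ^ L - p ^ L) ^ 2 := by
    rw [endToEnd, h.partialProduct_perturb, ← sub_sub, sub_eq_add_neg (M - _), ← neg_smul,
      frobenius_norm_add_sq, frobenius_norm_smul_sq, hsq _ _ (h.unit _) (h.unit _), Matrix.mul_smul,
      trace_smul, htr, sub_mulVec, dotProduct_sub, h.partialProduct_mulVec, dotProduct_smul, h.unit,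
      hm, endToEnd]
    simp only [smul_eq_mul, Fin.val_last]
    ring
  rw [loss, hend, Finset.sum_congr rfl fun i _ => hlayer i, Finset.sum_add_distrib, loss]
  simp only [Finset.sum_const, Finset.card_univ, Fintype.card_fin, nsmul_eq_mul]
  have : (L : ℝ) ≠ 0 := Nat.cast_ne_zero.2 hL
  field_simp
  ring

theorem scalar_le (h : SingularChain w p v) {m : ℝ} (hL : L ≠ 0) (hw : w ∈ minimizers M reg)
    (hm : v (Fin.last L) ⬝ᵥ M *ᵥ v 0 = m) (t : ℝ) :
    (m - p ^ L) ^ 2 + reg * p ^ 2 ≤ (m - t ^ L) ^ 2 + reg * t ^ 2 := by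
  have := hw (w + ofLayers fun i => (t - p) • vecMulVec (v i.succ) (v i.castSucc))
  rw [h.loss_perturb hL hm] at this
  linarith

end SingularChain

end Balance

/-! ### The scalar problem and its critical value. -/

section Scalar

/-- The nonnegative number `p` minimizes `t ↦ (m - t ^ L) ^ 2 + reg * t ^ 2`. -/
def IsScalarMinimizer (L : ℕ) (reg m p : ℝ) : Prop :=
  0 ≤ p ∧ ∀ t : ℝ, (m - p ^ L) ^ 2 + reg * p ^ 2 ≤ (m - t ^ L) ^ 2 + reg * t ^ 2

theorem IsScalarMinimizer.eq_zero {L : ℕ} {reg p : ℝ} (hreg : 0 < reg) (hL : L ≠ 0)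
    (h : IsScalarMinimizer L reg 0 p) : p = 0 := by
  have h0 := h.2 0
  rw [zero_pow hL] at h0
  have h1 : reg * p ^ 2 ≤ 0 := by nlinarith [sq_nonneg (0 - p ^ L)]
  have h2 : p ^ 2 ≤ 0 := by
    by_contra! h3
    exact absurd h1 (not_le.2 (mul_pos hreg h3))
  exact pow_eq_zero_iff (two_ne_zero) |>.1 (le_antisymm h2 (sq_nonneg p))

theorem hasDerivAt_scalarLoss (L : ℕ) (reg m t : ℝ) :
    HasDerivAt (fun t : ℝ => (m - t ^ L) ^ 2 + reg * t ^ 2)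
      (2 * (m - t ^ L) * -(L * t ^ (L - 1)) + reg * (2 * t)) t := by
  have h1 := ((hasDerivAt_pow L t).const_sub m).pow 2
  have h2 := (hasDerivAt_pow 2 t).const_mul reg
  convert! h1.add h2 using 1
  simp

theorem scalarLoss_deriv_eq {L : ℕ} (hL : 2 ≤ L) (reg m : ℝ) {t : ℝ} (ht : 0 < t) :
    2 * (m - t ^ L) * -(L * t ^ (L - 1)) + reg * (2 * t) =
      2 * L * t ^ (L - 1) * (t ^ L + reg / L * t ^ (2 - L : ℤ) - m) := by
  have hL0 : (L : ℝ) ≠ 0 := by positivity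
  have h1 : t ^ (L - 1) * t ^ (2 - L : ℤ) = t := by
    rw [← zpow_natCast, ← zpow_add₀ ht.ne', Nat.cast_sub (by omega)]
    have : (L : ℤ) - (1 : ℕ) + (2 - L) = 1 := by push_cast; ring
    rw [this, zpow_one]
  have h2 : 2 * L * t ^ (L - 1) * (t ^ L + reg / L * t ^ (2 - L : ℤ) - m) =
      2 * L * t ^ (L - 1) * (t ^ L - m) +
        2 * L * (reg / L) * (t ^ (L - 1) * t ^ (2 - L : ℤ)) := by ring
  rw [h2, h1]
  field_simp
  ring

theorem IsScalarMinimizer.deriv_eq_zero {L : ℕ} {reg m p : ℝ} (h : IsScalarMinimizer L reg m p) :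
    2 * (m - p ^ L) * -(L * p ^ (L - 1)) + reg * (2 * p) = 0 :=
  IsLocalMin.hasDerivAt_eq_zero (Filter.Eventually.of_forall h.2) (hasDerivAt_scalarLoss L reg m p)

/-- Positive critical points lie on one level of the strictly convex function `t ^ L + reg / L * t ^
(2 - L)`. Between two of them that function is below the level, so the scalar loss strictly
decreases and the left one is no minimizer. -/
theorem IsScalarMinimizer.not_lt_of_pos {L : ℕ} {reg m a b : ℝ} (hL : 2 ≤ L) (hreg : 0 < reg)
    (ha : IsScalarMinimizer L reg m a) (hb : IsScalarMinimizer L reg m b) (h0 : 0 < a) :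
    ¬ a < b := by
  intro hab
  have hL0 : (0 : ℝ) < L := by positivity
  have hcrit : ∀ {p : ℝ}, IsScalarMinimizer L reg m p → 0 < p →
      p ^ L + reg / L * p ^ (2 - L : ℤ) = m := by
    intro p hp hp0
    have := hp.deriv_eq_zero
    rw [scalarLoss_deriv_eq hL reg m hp0] at this
    have h2 : (2 * L * p ^ (L - 1) : ℝ) ≠ 0 := by positivity
    exact sub_eq_zero.1 ((mul_eq_zero.1 this).resolve_left h2)
  have hconv : StrictConvexOn ℝ (Set.Ioi 0)
      fun t : ℝ => t ^ L + reg / L * t ^ (2 - L : ℤ) := by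
    refine ((strictConvexOn_pow hL).subset Set.Ioi_subset_Ici_self
      (convex_Ioi 0)).add_convexOn ?_
    exact (convexOn_zpow _).smul (by positivity : 0 ≤ reg / (L : ℝ))
  have hanti : StrictAntiOn (fun t : ℝ => (m - t ^ L) ^ 2 + reg * t ^ 2) (Set.Icc a b) := by
    refine strictAntiOn_of_deriv_neg (convex_Icc a b) (by fun_prop) fun t ht => ?_
    rw [interior_Icc] at ht
    have ht0 : 0 < t := h0.trans ht.1
    rw [(hasDerivAt_scalarLoss L reg m t).deriv, scalarLoss_deriv_eq hL reg m ht0]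
    refine mul_neg_of_pos_of_neg (by positivity) (sub_neg.2 ?_)
    have := hconv.lt_on_openSegment (x := a) (y := b) (z := t) h0 (h0.trans hab) hab.ne
      (by rwa [openSegment_eq_Ioo hab])
    rwa [hcrit ha h0, hcrit hb (h0.trans hab), max_self] at this
  exact absurd (ha.2 b) (not_le.2 (hanti (Set.left_mem_Icc.2 hab.le) (Set.right_mem_Icc.2 hab.le)
    hab))

/-- Equal values at `0` and `b` and a vanishing derivative at `b` are two equations for `b` and `m`,
and they can be solved in closed form. -/
theorem IsScalarMinimizer.eq_criticalValue {L : ℕ} {reg m b : ℝ} (hL : 2 ≤ L) (hreg : 0 < reg)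
    (h0 : IsScalarMinimizer L reg m 0) (hb : IsScalarMinimizer L reg m b) (hb0 : 0 < b) :
    m = criticalValue L reg := by
  have hLpos : (0 : ℝ) < L := by positivity
  have hLne : L ≠ 0 := by omega
  have hbL : b ^ L = b ^ (L - 1) * b := (pow_sub_one_mul hLne b).symm
  have h1 : (b ^ L) ^ 2 - 2 * m * b ^ L + reg * b ^ 2 = 0 := by
    have := le_antisymm (h0.2 b) (hb.2 0)
    rw [zero_pow hLne] at this
    linarith
  have h2 : (L : ℝ) * b ^ L * (b ^ L - m) + reg * b ^ 2 = 0 := by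
    have := hb.deriv_eq_zero
    have h3 : (L : ℝ) * b ^ L * (b ^ L - m) + reg * b ^ 2 =
        (2 * (m - b ^ L) * -(L * b ^ (L - 1)) + reg * (2 * b)) * b / 2 := by
      rw [hbL]; ring
    rw [h3, this]; simp
  obtain ⟨q, hq⟩ : ∃ q : ℝ, q = 2 / L := ⟨_, rfl⟩
  have hLq : (L : ℝ) * q = 2 := by rw [hq]; field_simp
  have hu : 0 < b ^ L := by positivity
  have h3 : (b ^ L) ^ 2 = reg * (1 - q) * b ^ 2 := by
    have h4 : (L : ℝ) * ((b ^ L) ^ 2 - reg * (1 - q) * b ^ 2) = 0 := by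
      linear_combination 2 * h2 - L * h1 + reg * b ^ 2 * hLq
    rcases mul_eq_zero.1 h4 with h | h
    · exact absurd h hLpos.ne'
    · linarith
  -- This excludes `L = 2`, where `q = 1`: there the tie between `0` and a positive minimizer cannot
  -- occur.
  have hq1 : 0 < 1 - q := by
    have : 0 < reg * (1 - q) * b ^ 2 := by rw [← h3]; positivity
    exact pos_of_mul_pos_right (pos_of_mul_pos_left this (sq_nonneg b)) hreg.le
  have hm : m * (1 - q) = (1 - q / 2) * b ^ L := by
    have h4 : b ^ L * (m * (1 - q) - (1 - q / 2) * b ^ L) = 0 := by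
      linear_combination (-(1 - q) / 2) * h1 + (-1 / 2) * h3
    rcases mul_eq_zero.1 h4 with h | h
    · exact absurd h hu.ne'
    · linarith
  have hqpos : 0 < q := by rw [hq]; positivity
  have hpow : b ^ L = (reg * (1 - q)) ^ (1 / (2 - q)) := by
    have hb2 : b ^ 2 = (b ^ L) ^ q := by
      rw [← Real.rpow_natCast, ← Real.rpow_natCast, ← Real.rpow_mul hb0.le, hLq]
      norm_num
    have h6 : reg * (1 - q) = (b ^ L) ^ (2 - q) := by
      rw [Real.rpow_sub hu, ← hb2, eq_div_iff (by positivity), ← h3]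
      norm_cast
    rw [h6, ← Real.rpow_mul hu.le, mul_one_div_cancel (by linarith), Real.rpow_one]
  have hm' : m = (1 - q / 2) * b ^ L / (1 - q) := by rw [← hm]; field_simp
  have hexp : (q - 1) / (2 - q) = 1 / (2 - q) - 1 := by
    have : 2 - q ≠ 0 := by linarith
    field_simp
    ring
  rw [hm', hpow, Real.mul_rpow hreg.le hq1.le]
  simp only [criticalValue]
  rw [← hq, hexp, Real.rpow_sub hq1, Real.rpow_one]
  ring

theorem IsScalarMinimizer.unique {L : ℕ} {reg m a b : ℝ} (hL : 2 ≤ L) (hreg : 0 < reg)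
    (hm : m ≠ 0 → m ≠ criticalValue L reg)
    (ha : IsScalarMinimizer L reg m a) (hb : IsScalarMinimizer L reg m b) : a = b := by
  rcases eq_or_ne m 0 with rfl | hm0
  · rw [ha.eq_zero hreg (by omega), hb.eq_zero hreg (by omega)]
  have key : ∀ {a b : ℝ}, IsScalarMinimizer L reg m a → IsScalarMinimizer L reg m b →
      ¬ a < b := by
    intro a b ha hb hab
    rcases ha.1.eq_or_lt with h | h
    · subst h
      exact hm hm0 (ha.eq_criticalValue hL hreg hb hab)
    · exact ha.not_lt_of_pos hL hreg hb h hab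
  exact le_antisymm (not_lt.1 (key hb ha)) (not_lt.1 (key ha hb))

end Scalar

/-! ### From joint eigenvectors to scalar minimizers. -/

section Eigenvectors

theorem rank_lt_iff_exists_unit_mulVec_eq_zero {n : ℕ} (A : Matrix (Fin n) (Fin n) ℝ) :
    A.rank < n ↔ ∃ u : Fin n → ℝ, u ⬝ᵥ u = 1 ∧ A *ᵥ u = 0 := by
  have h : A.rank < n ↔ ∃ u : Fin n → ℝ, u ≠ 0 ∧ A *ᵥ u = 0 := by
    rw [exists_mulVec_eq_zero_iff]
    constructor
    · intro h
      by_contra hdet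
      have := rank_of_isUnit A ((isUnit_iff_isUnit_det A).2 (isUnit_iff_ne_zero.2 hdet))
      rw [Fintype.card_fin] at this
      omega
    · intro h
      obtain ⟨u, hu, hAu⟩ := exists_mulVec_eq_zero_iff.2 h
      have hk := A.mulVecLin.finrank_range_add_finrank_ker
      rw [Module.finrank_fin_fun] at hk
      have : 0 < Module.finrank ℝ A.mulVecLin.ker :=
        Module.finrank_pos_iff_exists_ne_zero.2
          ⟨⟨u, by simpa using hAu⟩, by simpa [Subtype.ext_iff] using hu⟩
      rw [Matrix.rank]
      omega
  rw [h]
  constructor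
  · rintro ⟨u, hu, hAu⟩
    have h0 : 0 < u ⬝ᵥ u := by
      refine lt_of_le_of_ne (Finset.sum_nonneg fun i _ => mul_self_nonneg _) fun h => hu ?_
      exact dotProduct_self_eq_zero.1 h.symm
    refine ⟨(√(u ⬝ᵥ u))⁻¹ • u, ?_, by rw [mulVec_smul, hAu, smul_zero]⟩
    rw [smul_dotProduct, dotProduct_smul, smul_eq_mul, smul_eq_mul, ← mul_assoc, ← mul_inv,
      Real.mul_self_sqrt h0.le, inv_mul_cancel₀ h0.ne']
  · rintro ⟨u, hu, hAu⟩
    exact ⟨u, by rintro rfl; simp at hu, hAu⟩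

theorem pow_mulVec_of_eigenvector {n : ℕ} {A : Matrix (Fin n) (Fin n) ℝ} {v : Fin n → ℝ} {s : ℝ}
    (h : A *ᵥ v = s • v) (k : ℕ) : (A ^ k) *ᵥ v = s ^ k • v := by
  induction k with
  | zero => simp
  | succ k ih => rw [pow_succ, ← mulVec_mulVec, h, mulVec_smul, ih, smul_smul, pow_succ']

theorem mulVec_dotProduct_mulVec {m n : ℕ} (A B : Matrix (Fin m) (Fin n) ℝ) (v : Fin n → ℝ) :
    (A *ᵥ v) ⬝ᵥ (B *ᵥ v) = v ⬝ᵥ ((Aᵀ * B) *ᵥ v) := by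
  rw [← mulVec_mulVec, dotProduct_mulVec v, vecMul_transpose]

theorem mulVec_eq_zero_of_transpose_mul_self {m n : ℕ} {A : Matrix (Fin m) (Fin n) ℝ}
    {v : Fin n → ℝ} (h : (Aᵀ * A) *ᵥ v = 0) : A *ᵥ v = 0 := by
  rw [← dotProduct_self_eq_zero (R := ℝ), mulVec_dotProduct_mulVec, h, dotProduct_zero]

theorem eigenvalue_nonneg_of_transpose_mul_self {m n : ℕ} {A : Matrix (Fin m) (Fin n) ℝ}
    {v : Fin n → ℝ} {μ : ℝ} (hv : v ⬝ᵥ v = 1) (h : (Aᵀ * A) *ᵥ v = μ • v) : 0 ≤ μ := by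
  have h1 := mulVec_dotProduct_mulVec A A v
  rw [h, dotProduct_smul, hv, smul_eq_mul, mul_one] at h1
  rw [← h1]
  exact Finset.sum_nonneg fun i _ => mul_self_nonneg _

variable {L : ℕ} {d : Fin (L + 1) → ℕ}
variable {M : Matrix (Fin (d (Fin.last L))) (Fin (d 0)) ℝ} {reg : ℝ} {w : Params d}
variable {v : Fin (d 0) → ℝ} {s μ : ℝ}

theorem smul_endToEnd_mulVec (hc : reg / L ≠ 0) (hw : w ∈ minimizers M reg)
    (hs : gram M reg w 0 *ᵥ v = s • v) :
    (reg / L * s + s ^ L) • (endToEnd w *ᵥ v) = s ^ L • (M *ᵥ v) := by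
  have h := congrArg (· *ᵥ v) (target_mul_gram_pow hc hw)
  simp only [← mulVec_mulVec, add_mulVec, smul_mulVec, hs, pow_mulVec_of_eigenvector hs,
    mulVec_smul, mulVec_add, smul_smul] at h
  rw [h, add_smul]

theorem endToEnd_mulVec_eq_zero (hL : L ≠ 0) (hc : reg / L ≠ 0) (hw : w ∈ minimizers M reg)
    (hs : gram M reg w 0 *ᵥ v = 0) : endToEnd w *ᵥ v = 0 := by
  apply mulVec_eq_zero_of_transpose_mul_self
  rw [transpose_endToEnd_mul_self hc hw,
    pow_mulVec_of_eigenvector (s := 0) (by rw [hs, zero_smul]), zero_pow hL, zero_smul]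

/-- The chain consists of the normalized images of `v` under the partial products; the normalization
is right because the `k`-th partial product scales the squared length by `s ^ k`. -/
theorem singularChain_of_pos (hc : reg / L ≠ 0) (hw : w ∈ minimizers M reg)
    (hv : v ⬝ᵥ v = 1) (hs : gram M reg w 0 *ᵥ v = s • v) (h0 : 0 < s) :
    SingularChain w (√s) fun k => (√s ^ (k : ℕ))⁻¹ • (partialProduct w k *ᵥ v) := by
  have hp : 0 < √s := Real.sqrt_pos.2 h0
  have hps : √s * √s = s := Real.mul_self_sqrt h0.le
  refine ⟨fun k => ?_, fun i => ?_, fun i => ?_⟩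
  · rw [smul_dotProduct, dotProduct_smul, mulVec_dotProduct_mulVec,
      transpose_partialProduct_mul_self hc hw, pow_mulVec_of_eigenvector hs, dotProduct_smul, hv]
    simp only [smul_eq_mul, mul_one]
    rw [← mul_assoc, ← mul_inv, ← mul_pow, hps, inv_mul_cancel₀ (by positivity)]
  · rw [mulVec_smul, mulVec_mulVec, ← partialProduct_succ, smul_smul, Fin.val_castSucc,
      Fin.val_succ]
    congr 1
    field_simp
    ring
  · rw [mulVec_smul, partialProduct_succ, mulVec_mulVec, ← Matrix.mul_assoc,
      ← gram_castSucc hc hw, ← partialProduct_mul_gram_zero hc hw, ← mulVec_mulVec, hs,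
      mulVec_smul, smul_smul, smul_smul, Fin.val_castSucc, Fin.val_succ]
    congr 1
    nth_rewrite 2 [← hps]
    field_simp
    ring

/-- For `p = 0` the members of the chain need not be related: each must only be a unit vector in the
kernel of its Gram matrix. All Gram matrices have equal rank, kernels at both ends make it smaller
than both end widths, and the width hypothesis passes this on to every interface. -/
theorem exists_singularChain_zero (hL : L ≠ 0)
    (hd : ∀ i : Fin (L + 1), min (d 0) (d (Fin.last L)) ≤ d i)
    (hc : reg / L ≠ 0) (hw : w ∈ minimizers M reg)
    (hv : v ⬝ᵥ v = 1) (hs : gram M reg w 0 *ᵥ v = 0)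
    {u : Fin (d (Fin.last L)) → ℝ} (hu : u ⬝ᵥ u = 1) (hu0 : gram M reg w (Fin.last L) *ᵥ u = 0) :
    ∃ x : ∀ k : Fin (L + 1), Fin (d k) → ℝ,
      SingularChain w 0 x ∧ x 0 = v ∧ x (Fin.last L) = u := by
  have hlt : ∀ k, (gram M reg w k).rank < d k := by
    intro k
    have h1 := (rank_lt_iff_exists_unit_mulVec_eq_zero _).2 ⟨v, hv, hs⟩
    have h2 := (rank_lt_iff_exists_unit_mulVec_eq_zero _).2 ⟨u, hu, hu0⟩
    rw [rank_gram hc hw] at h2 ⊢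
    exact (lt_min h1 h2).trans_le (hd k)
  choose y hy hy0 using fun k => (rank_lt_iff_exists_unit_mulVec_eq_zero _).1 (hlt k)
  have hne : (0 : Fin (L + 1)) ≠ Fin.last L := by
    simpa [Fin.ext_iff] using hL.symm
  set x := Function.update (Function.update y 0 v) (Fin.last L) u with hx
  have hx1 : x 0 = v := by
    rw [hx, Function.update_of_ne hne, Function.update_self]
  have hx2 : x (Fin.last L) = u := by rw [hx, Function.update_self]
  have hker : ∀ k, x k ⬝ᵥ x k = 1 ∧ gram M reg w k *ᵥ x k = 0 := by
    intro k
    by_cases hk : k = Fin.last L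
    · subst hk
      rw [hx2]
      exact ⟨hu, hu0⟩
    by_cases hk0 : k = 0
    · subst hk0
      rw [hx1]
      exact ⟨hv, hs⟩
    · rw [hx, Function.update_of_ne hk, Function.update_of_ne hk0]
      exact ⟨hy k, hy0 k⟩
  refine ⟨x, ⟨fun k => (hker k).1, fun i => ?_, fun i => ?_⟩, hx1, hx2⟩
  · rw [zero_smul]
    apply mulVec_eq_zero_of_transpose_mul_self
    rw [← gram_castSucc hc hw]
    exact (hker _).2
  · rw [zero_smul]
    apply mulVec_eq_zero_of_transpose_mul_self
    rw [transpose_transpose, ← gram_succ hc hw]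
    exact (hker _).2

theorem isScalarMinimizer_of_jointEigenvector (hL : L ≠ 0) (hreg : 0 < reg)
    (hd : ∀ i : Fin (L + 1), min (d 0) (d (Fin.last L)) ≤ d i)
    (hw : w ∈ minimizers M reg) (hv : v ⬝ᵥ v = 1) (hs : gram M reg w 0 *ᵥ v = s • v)
    (hμ : (Mᵀ * M) *ᵥ v = μ • v) :
    0 ≤ s ∧ IsScalarMinimizer L reg (√μ) (√s) := by
  have hcpos : 0 < reg / L := by positivity
  have hc : reg / L ≠ 0 := hcpos.ne'
  have hs0 : 0 ≤ s := by
    obtain ⟨a, A, hA⟩ := exists_gram_zero_eq hL hc hw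
    exact eigenvalue_nonneg_of_transpose_mul_self hv (hA ▸ hs)
  have hμ0 : 0 ≤ μ := eigenvalue_nonneg_of_transpose_mul_self hv hμ
  refine ⟨hs0, Real.sqrt_nonneg _, fun t => ?_⟩
  rcases hs0.eq_or_lt with rfl | hspos
  · rw [Real.sqrt_zero]
    rw [zero_smul] at hs
    rcases hμ0.eq_or_lt with rfl | hμpos
    · rw [Real.sqrt_zero, zero_pow hL]
      have h1 := sq_nonneg (0 - t ^ L)
      have h2 := mul_nonneg hreg.le (sq_nonneg t)
      linarith
    have hm : 0 < √μ := Real.sqrt_pos.2 hμpos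
    have hmm : √μ * √μ = μ := Real.mul_self_sqrt hμ0
    have hMM : (M *ᵥ v) ⬝ᵥ (M *ᵥ v) = μ := by
      rw [mulVec_dotProduct_mulVec, hμ, dotProduct_smul, hv, smul_eq_mul, mul_one]
    obtain ⟨x, hx, hx0, hxL⟩ := exists_singularChain_zero hL hd hc hw hv hs
      -- The end of the chain is the left singular vector of `M`, so that the chain sees the
      -- singular value `√μ`. It lies in the kernel of the last Gram matrix because `Pᵀ M = c G + G
      -- ^ L` kills `v`.
      (u := (√μ)⁻¹ • (M *ᵥ v))
      (by
        rw [smul_dotProduct, dotProduct_smul, hMM, smul_eq_mul, smul_eq_mul, ← mul_assoc,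
          ← mul_inv, hmm, inv_mul_cancel₀ hμpos.ne'])
      (by
        have h1 : (reg / L) • (gram M reg w (Fin.last L) *ᵥ (M *ᵥ v)) = 0 := by
          rw [← smul_mulVec, smul_gram_last hc, mulVec_mulVec, Matrix.mul_assoc,
            transpose_endToEnd_mul_target hc hw, ← mulVec_mulVec, add_mulVec, smul_mulVec, hs,
            pow_mulVec_of_eigenvector (s := 0) (by rw [hs, zero_smul]), zero_pow hL]
          simp
        rw [mulVec_smul, (smul_eq_zero.1 h1).resolve_left hc, smul_zero])
    refine hx.scalar_le hL hw ?_ t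
    rw [hx0, hxL, smul_dotProduct, hMM, smul_eq_mul]
    field_simp
    exact (Real.sq_sqrt hμ0).symm
  · refine (singularChain_of_pos hc hw hv hs hspos).scalar_le hL hw ?_ t
    have hp : 0 < √s := Real.sqrt_pos.2 hspos
    have hps : √s * √s = s := Real.mul_self_sqrt hs0
    -- This equation identifies the entry of `M` between the two ends of the chain as `√μ`.
    have hsq : μ * s ^ L = (reg / L * s + s ^ L) ^ 2 := by
      have h1 : ((reg / L) • gram M reg w 0 + gram M reg w 0 ^ L) *ᵥ v =
          (reg / L * s + s ^ L) • v := by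
        rw [add_mulVec, smul_mulVec, hs, pow_mulVec_of_eigenvector hs, smul_smul, add_smul]
      have h2 := congrArg (fun A => v ⬝ᵥ (A *ᵥ v)) (target_gram_mul_gram_pow hL hc hw)
      simp only [← mulVec_mulVec _ (Mᵀ * M), ← mulVec_mulVec _ ((reg / (L : ℝ)) • _ + _), h1,
        pow_mulVec_of_eigenvector hs, mulVec_smul, hμ, dotProduct_smul, hv, smul_eq_mul] at h2
      linarith
    rw [partialProduct_zero, one_mulVec]
    simp only [Fin.val_zero, Fin.val_last, pow_zero, inv_one, one_smul]
    rw [← endToEnd, smul_dotProduct, mulVec_dotProduct_mulVec,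
      transpose_endToEnd_mul_target hc hw, add_mulVec,
      smul_mulVec, hs, pow_mulVec_of_eigenvector hs, smul_smul, ← add_smul, dotProduct_smul, hv]
    simp only [smul_eq_mul, mul_one]
    symm
    rw [Real.sqrt_eq_iff_mul_self_eq hμ0 (by positivity)]
    rw [mul_mul_mul_comm, ← mul_inv, ← mul_pow, hps, ← sq, ← hsq]
    field_simp

theorem endToEnd_mulVec_eq_smul (hL : L ≠ 0) (hreg : 0 < reg)
    (hw : w ∈ minimizers M reg) (hs0 : 0 ≤ s) (hs : gram M reg w 0 *ᵥ v = s • v) :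
    endToEnd w *ᵥ v = (s ^ L / (reg / L * s + s ^ L)) • (M *ᵥ v) := by
  have hcpos : 0 < reg / L := by positivity
  rcases hs0.eq_or_lt with rfl | hspos
  -- For `s = 0` the coefficient is `0 / 0`, which evaluates to `0`, as needed.
  · rw [endToEnd_mulVec_eq_zero hL hcpos.ne' hw (by rw [hs, zero_smul]), zero_pow hL, zero_div,
      zero_smul]
  · have h := smul_endToEnd_mulVec hcpos.ne' hw hs
    have h1 : reg / L * s + s ^ L ≠ 0 := by positivity
    rw [div_eq_inv_mul, ← smul_smul, ← h, smul_smul, inv_mul_cancel₀ h1, one_smul]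

end Eigenvectors

/-! ### Existence of minimizers, uniqueness of the product and of the layer norm. -/

section Uniqueness

/-- A positive singular value has index below the rank, hence below `min m n`. Zero is left out: `Aᵀ
* A` may be singular merely because `m < n`. -/
theorem exists_singularValue_eq {m n : ℕ} {A : Matrix (Fin m) (Fin n) ℝ} {v : Fin n → ℝ} {μ : ℝ}
    (hv : v ≠ 0) (hμ : (Aᵀ * A) *ᵥ v = μ • v) (h0 : 0 < μ) :
    ∃ i : Fin (min m n), singularValue A i = √μ := by
  set T := toEuclideanLin A with hT
  have heig : Module.End.HasEigenvalue (LinearMap.adjoint T ∘ₗ T) μ := by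
    refine Module.End.hasEigenvalue_of_hasEigenvector (x := WithLp.toLp 2 v)
      ⟨Module.End.mem_eigenspace_iff.2 ?_, by simpa using hv⟩
    rw [hT, ← toEuclideanLin_conjTranspose_eq_adjoint, conjTranspose_eq_transpose_of_trivial,
      LinearMap.comp_apply, toLpLin_apply, toLpLin_apply]
    simp [mulVec_mulVec, hμ]
  obtain ⟨i, hi⟩ := T.isSymmetric_adjoint_comp_self.exists_eigenvalues_eq rfl heig
  have hi' : T.singularValues i = √μ := by
    rw [T.singularValues_fin rfl i]
    exact congrArg Real.sqrt hi
  have hlt : (i : ℕ) < Module.finrank ℝ T.range := by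
    rw [← T.singularValues_pos_iff_lt_finrank_range, hi']
    exact Real.sqrt_pos.2 h0
  have h1 : Module.finrank ℝ T.range ≤ m := by
    simpa using Submodule.finrank_le T.range
  have h2 : Module.finrank ℝ T.range ≤ n := by
    simpa using T.finrank_range_le
  exact ⟨⟨i, lt_min (hlt.trans_le h1) (hlt.trans_le h2)⟩, hi'⟩

theorem isSymmetric_toEuclideanLin_of_transpose_eq {n : ℕ} {A : Matrix (Fin n) (Fin n) ℝ}
    (h : Aᵀ = A) : (toEuclideanLin A).IsSymmetric :=
  isSymmetric_toEuclideanLin_iff.2 (by rwa [IsHermitian, conjTranspose_eq_transpose_of_trivial])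

theorem mem_eigenspace_toEuclideanLin {n : ℕ} {A : Matrix (Fin n) (Fin n) ℝ} {μ : ℝ}
    {x : EuclideanSpace ℝ (Fin n)} :
    x ∈ Module.End.eigenspace (toEuclideanLin A) μ ↔ A *ᵥ x.ofLp = μ • x.ofLp := by
  rw [Module.End.mem_eigenspace_iff, toLpLin_apply]
  constructor
  · intro h
    simpa using congrArg WithLp.ofLp h
  · intro h
    rw [h, WithLp.toLp_smul, WithLp.toLp_ofLp]

variable {L : ℕ} {d : Fin (L + 1) → ℕ}
variable {M : Matrix (Fin (d (Fin.last L))) (Fin (d 0)) ℝ} {reg : ℝ}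

theorem sqrt_ne_criticalValue {v : Fin (d 0) → ℝ} {μ : ℝ}
    (hM : M ∉ exceptionalSet L reg (d (Fin.last L)) (d 0)) (hv : v ≠ 0)
    (hμ : (Mᵀ * M) *ᵥ v = μ • v) (h0 : √μ ≠ 0) : √μ ≠ criticalValue L reg := by
  intro h
  obtain ⟨i, hi⟩ := exists_singularValue_eq hv hμ (Real.sqrt_ne_zero'.1 h0)
  exact hM (Set.mem_iUnion.2 ⟨i, hi.trans h⟩)

theorem exists_endToEnd_mulVec_eq (hL : 2 ≤ L) (hreg : 0 < reg)
    (hd : ∀ i : Fin (L + 1), min (d 0) (d (Fin.last L)) ≤ d i)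
    (hM : M ∉ exceptionalSet L reg (d (Fin.last L)) (d 0)) (μ : ℝ) :
    ∃ κ : ℝ, ∀ w ∈ minimizers M reg, ∀ v : Fin (d 0) → ℝ, (Mᵀ * M) *ᵥ v = μ • v →
      endToEnd w *ᵥ v = κ • (M *ᵥ v) := by
  have hL0 : L ≠ 0 := by omega
  have hcpos : 0 < reg / L := by positivity
  -- The scalar minimizer is chosen before `w`, so that `κ` depends on `μ` alone. Its existence is
  -- supplied later by any joint eigenvector.
  set p := Classical.epsilon (IsScalarMinimizer L reg (√μ)) with hp
  refine ⟨(p ^ 2) ^ L / (reg / L * p ^ 2 + (p ^ 2) ^ L), fun w hw v hv => ?_⟩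
  set κ := (p ^ 2) ^ L / (reg / L * p ^ 2 + (p ^ 2) ^ L) with hκ
  have hcomm : Commute (toEuclideanLin (Mᵀ * M)) (toEuclideanLin (gram M reg w 0)) := by
    have := (commute_gram_zero hL0 hcpos.ne' hw).eq
    refine LinearMap.ext fun x => ?_
    simp only [Module.End.mul_apply, toLpLin_apply, mulVec_mulVec, this]
  -- By commutation, the eigenspace of `Mᵀ * M` is spanned by joint eigenvectors with `G`, so it
  -- suffices to check these.
  have hsup := LinearMap.IsSymmetric.iSup_eigenspace_inf_eigenspace_of_commute (α := μ)
    (isSymmetric_toEuclideanLin_of_transpose_eq (transpose_gram_zero hL0 hcpos.ne' hw)) hcomm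
  have hle : Module.End.eigenspace (toEuclideanLin (Mᵀ * M)) μ ≤
      (toEuclideanLin (endToEnd w - κ • M)).ker := by
    rw [← hsup]
    refine iSup_le fun s x hx => ?_
    have hx1 := mem_eigenspace_toEuclideanLin.1 hx.1
    have hx2 := mem_eigenspace_toEuclideanLin.1 hx.2
    rw [LinearMap.mem_ker, toLpLin_apply]
    rcases eq_or_ne x 0 with rfl | hx0
    · simp
    have hnorm : x.ofLp ⬝ᵥ x.ofLp = ‖x‖ ^ 2 := by
      rw [EuclideanSpace.real_norm_sq_eq]
      exact Finset.sum_congr rfl fun i _ => (sq _).symm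
    have hunit : (‖x‖⁻¹ • x.ofLp) ⬝ᵥ (‖x‖⁻¹ • x.ofLp) = 1 := by
      rw [smul_dotProduct, dotProduct_smul, hnorm]
      simp only [smul_eq_mul]
      field_simp
    obtain ⟨hs0, hmin⟩ := isScalarMinimizer_of_jointEigenvector hL0 hreg hd hw hunit (s := s)
      (μ := μ) (by rw [mulVec_smul, hx2, smul_comm]) (by rw [mulVec_smul, hx1, smul_comm])
    have hps : p = √s := IsScalarMinimizer.unique hL hreg
      (sqrt_ne_criticalValue hM (by simpa using hx0) hx1) (Classical.epsilon_spec ⟨_, hmin⟩) hmin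
    have := endToEnd_mulVec_eq_smul hL0 hreg hw hs0 hx2
    rw [hκ, hps, Real.sq_sqrt hs0, sub_mulVec, this, smul_mulVec, sub_self, WithLp.toLp_zero]
  have h1 := hle (x := WithLp.toLp 2 v) (mem_eigenspace_toEuclideanLin.2 hv)
  rw [LinearMap.mem_ker, toLpLin_apply] at h1
  have h2 := congrArg WithLp.ofLp h1
  rw [sub_mulVec, smul_mulVec] at h2
  exact sub_eq_zero.1 h2

theorem endToEnd_eq_of_mem_minimizers (hL : 2 ≤ L) (hreg : 0 < reg)
    (hd : ∀ i : Fin (L + 1), min (d 0) (d (Fin.last L)) ≤ d i)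
    (hM : M ∉ exceptionalSet L reg (d (Fin.last L)) (d 0)) {w w' : Params d}
    (hw : w ∈ minimizers M reg) (hw' : w' ∈ minimizers M reg) : endToEnd w = endToEnd w' := by
  have hsymm : (toEuclideanLin (Mᵀ * M)).IsSymmetric :=
    isSymmetric_toEuclideanLin_of_transpose_eq (by rw [transpose_mul, transpose_transpose])
  have htop := Submodule.orthogonal_eq_bot_iff.1 hsymm.orthogonalComplement_iSup_eigenspaces_eq_bot
  have hker : (toEuclideanLin (endToEnd w - endToEnd w')).ker = ⊤ := by
    rw [eq_top_iff, ← htop]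
    refine iSup_le fun μ x hx => ?_
    obtain ⟨κ, hκ⟩ := exists_endToEnd_mulVec_eq hL hreg hd hM μ
    have hx1 := mem_eigenspace_toEuclideanLin.1 hx
    rw [LinearMap.mem_ker, toLpLin_apply, sub_mulVec, hκ w hw _ hx1, hκ w' hw' _ hx1,
      sub_self, WithLp.toLp_zero]
  rw [LinearMap.ker_eq_top] at hker
  exact sub_eq_zero.1 ((LinearEquiv.map_eq_zero_iff _).1 hker)

/-- Minimizers have equal loss and equal product, hence equal regularizers, and balance divides the
regularizer evenly among the layers. -/
theorem norm_layer_eq_of_mem_minimizers (hL : 2 ≤ L) (hreg : 0 < reg)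
    (hd : ∀ i : Fin (L + 1), min (d 0) (d (Fin.last L)) ≤ d i)
    (hM : M ∉ exceptionalSet L reg (d (Fin.last L)) (d 0)) {w w' : Params d}
    (hw : w ∈ minimizers M reg) (hw' : w' ∈ minimizers M reg) (i j : Fin L) :
    ‖layer w i‖ = ‖layer w' j‖ := by
  have hLpos : (0 : ℝ) < L := by positivity
  have hc : reg / L ≠ 0 := by positivity
  have h1 := le_antisymm (hw w') (hw' w)
  rw [loss, loss, endToEnd_eq_of_mem_minimizers hL hreg hd hM hw hw'] at h1
  simp only [norm_layer_sq hc hw, norm_layer_sq hc hw', Finset.sum_const, Finset.card_univ,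
    Fintype.card_fin, nsmul_eq_mul] at h1
  have h2 : (gram M reg w 0).trace = (gram M reg w' 0).trace :=
    mul_left_cancel₀ hLpos.ne' (mul_left_cancel₀ hc (add_left_cancel h1))
  rw [← abs_of_nonneg (norm_nonneg (layer w i)), ← abs_of_nonneg (norm_nonneg (layer w' j)),
    ← sq_eq_sq_iff_abs_eq_abs, norm_layer_sq hc hw, norm_layer_sq hc hw', h2]

theorem sum_norm_layer_sq (w : Params d) : ∑ i : Fin L, ‖layer w i‖ ^ 2 = ‖w‖ ^ 2 := by
  rw [EuclideanSpace.real_norm_sq_eq, Fintype.sum_sigma]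
  refine Finset.sum_congr rfl fun i _ => ?_
  rw [frobenius_norm_sq, Fintype.sum_prod_type]
  rfl

theorem contDiff_partialProduct_apply (k : Fin (L + 1)) (a : Fin (d k)) (b : Fin (d 0)) :
    ContDiff ℝ 2 fun w : Params d => partialProduct w k a b := by
  induction k using Fin.induction with
  | zero => exact contDiff_const
  | succ i ih =>
    simp only [partialProduct_succ, Matrix.mul_apply]
    refine ContDiff.sum fun j _ => ContDiff.mul ?_ (ih j)
    simp only [layer, of_apply]
    fun_prop

theorem contDiff_loss (M : Matrix (Fin (d (Fin.last L))) (Fin (d 0)) ℝ) (reg : ℝ) :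
    ContDiff ℝ 2 (loss M reg) := by
  have h : loss M reg = fun w : Params d => ∑ a, ∑ b, (M a b - endToEnd w a b) ^ 2 +
      reg / L * ‖w‖ ^ 2 := by
    funext w
    rw [loss, sum_norm_layer_sq, frobenius_norm_sq]
    rfl
  rw [h]
  refine ContDiff.add (ContDiff.sum fun a _ => ContDiff.sum fun b _ => ?_)
    (contDiff_const.mul (contDiff_norm_sq ℝ))
  exact (contDiff_const.sub (contDiff_partialProduct_apply _ a b)).pow 2

theorem minimizers_nonempty (hreg : 0 < reg / L) : (minimizers M reg).Nonempty := by
  refine (contDiff_loss M reg).continuous.exists_forall_le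
    (Filter.tendsto_atTop_mono (f := fun w : Params d => reg / L * ‖w‖ ^ 2) (fun w => ?_) ?_)
  · rw [loss, sum_norm_layer_sq]
    exact le_add_of_nonneg_left (sq_nonneg _)
  · exact ((Filter.tendsto_pow_atTop two_ne_zero).comp
      tendsto_norm_cocompact_atTop).const_mul_atTop hreg

end Uniqueness

/-! ### The trace of the Hessian and its lower bound. -/

section Hessian

theorem hessian_apply_self_of_quadratic {ι : Type*} [Fintype ι] [DecidableEq ι]
    {f : EuclideanSpace ℝ ι → ℝ} (hf : ContDiff ℝ 2 f) {x : EuclideanSpace ℝ ι} {j : ι} {b a : ℝ}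
    (h : ∀ t : ℝ, f (x + t • EuclideanSpace.single j 1) = f x + t * b + t ^ 2 * a) :
    hessian f x j j = 2 * a := by
  set e : EuclideanSpace ℝ ι := EuclideanSpace.single j 1 with he
  have hline : ∀ t : ℝ, HasDerivAt (fun t : ℝ => x + t • e) e t := fun t => by
    simpa using ((hasDerivAt_id t).smul_const e).const_add x
  have h1 : ∀ t : ℝ, fderiv ℝ f (x + t • e) e = b + 2 * t * a := by
    intro t
    have hd := (hf.differentiable two_ne_zero (x + t • e)).hasFDerivAt.comp_hasDerivAt t (hline t)
    have hq : HasDerivAt (fun t : ℝ => f x + t * b + t ^ 2 * a) (b + 2 * t * a) t := by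
      have := (((hasDerivAt_id t).mul_const b).const_add (f x)).add
        ((hasDerivAt_pow 2 t).mul_const a)
      convert! this using 1
      simp
    refine hd.unique ?_
    convert! hq using 1
    exact funext h
  have hg : Differentiable ℝ fun y => fderiv ℝ f y e :=
    ((hf.fderiv_right (m := 1) le_rfl).differentiable one_ne_zero).clm_apply
      (differentiable_const e)
  have hd := (hg (x + (0 : ℝ) • e)).hasFDerivAt.comp_hasDerivAt 0 (hline 0)
  have hq : HasDerivAt (fun t : ℝ => b + 2 * t * a) (2 * a) 0 := by
    simpa using (((hasDerivAt_id (0 : ℝ)).const_mul 2).mul_const a).const_add b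
  have := hd.unique (by
    convert! hq using 1
    exact funext h1)
  rwa [zero_smul, add_zero] at this

theorem frobenius_norm_single_sq {m n : ℕ} (a : Fin m) (b : Fin n) :
    ‖Matrix.single a b (1 : ℝ)‖ ^ 2 = 1 := by
  rw [frobenius_norm_sq_eq_trace]
  simp

/-- Each summand is the squared norm of column `a` of `A` times row `b` of `B`, a rank-one matrix,
so the sum factors. -/
theorem sum_frobenius_norm_mul_single_mul_sq {k l m n : ℕ} (A : Matrix (Fin k) (Fin l) ℝ)
    (B : Matrix (Fin m) (Fin n) ℝ) :
    ∑ a : Fin l, ∑ b : Fin m, ‖A * Matrix.single a b (1 : ℝ) * B‖ ^ 2 = ‖A‖ ^ 2 * ‖B‖ ^ 2 := by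
  have h : ∀ (a : Fin l) (b : Fin m), ‖A * Matrix.single a b (1 : ℝ) * B‖ ^ 2 =
      (∑ i, A i a ^ 2) * ∑ j, B b j ^ 2 := by
    intro a b
    rw [frobenius_norm_sq, Finset.sum_mul_sum]
    refine Finset.sum_congr rfl fun i _ => Finset.sum_congr rfl fun j _ => ?_
    rw [single_eq_single_vecMulVec_single, mul_vecMulVec, vecMulVec_mul, vecMulVec_apply]
    simp [mul_pow]
  simp only [h, ← Finset.mul_sum, ← Finset.sum_mul]
  rw [frobenius_norm_sq, frobenius_norm_sq, Finset.sum_comm]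

variable {L : ℕ} {d : Fin (L + 1) → ℕ}
variable {M : Matrix (Fin (d (Fin.last L))) (Fin (d 0)) ℝ} {reg : ℝ}

theorem smul_single_eq_ofLayers (t : ℝ) (i : Fin L) (a : Fin (d i.succ)) (b : Fin (d i.castSucc)) :
    t • (EuclideanSpace.single ⟨i, (a, b)⟩ 1 : Params d) =
      ofLayers (Pi.single i (t • Matrix.single a b 1)) := by
  ext ⟨i', a', b'⟩
  by_cases hi : i' = i
  · subst hi
    simp [ofLayers, Matrix.single_apply, PiLp.single_apply, Prod.ext_iff, eq_comm]
  · have : (⟨i', (a', b')⟩ : ParamIndex d) ≠ ⟨i, (a, b)⟩ := fun h => hi (congrArg Sigma.fst h)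
    simp [ofLayers, Pi.single_eq_of_ne hi, this]

theorem hessian_loss_apply_self (M : Matrix (Fin (d (Fin.last L))) (Fin (d 0)) ℝ) (reg : ℝ)
    (w : Params d) (i : Fin L) (a : Fin (d i.succ)) (b : Fin (d i.castSucc)) :
    hessian (loss M reg) w ⟨i, (a, b)⟩ ⟨i, (a, b)⟩ =
      2 * (‖suffixProduct w i.succ * Matrix.single a b (1 : ℝ) * partialProduct w i.castSucc‖ ^ 2 +
        reg / L) := by
  refine hessian_apply_self_of_quadratic (contDiff_loss M reg)
    (b := 2 * (reg / L * ((layer w i)ᵀ * Matrix.single a b (1 : ℝ)).trace -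
        (((suffixProduct w i.succ)ᵀ * (M - endToEnd w) *
          (partialProduct w i.castSucc)ᵀ)ᵀ * Matrix.single a b (1 : ℝ)).trace)) fun t => ?_
  rw [smul_single_eq_ofLayers, loss_add_single]
  simp only [Matrix.mul_smul, Matrix.smul_mul, Matrix.trace_smul, frobenius_norm_smul_sq,
    smul_eq_mul, frobenius_norm_single_sq]
  ring

theorem trace_hessian_loss (M : Matrix (Fin (d (Fin.last L))) (Fin (d 0)) ℝ) (reg : ℝ)
    (w : Params d) :
    (hessian (loss M reg) w).trace =
      ∑ i : Fin L, 2 * (‖suffixProduct w i.succ‖ ^ 2 * ‖partialProduct w i.castSucc‖ ^ 2) +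
        2 * reg / L * numParams d := by
  have h : (2 * reg / L * numParams d : ℝ) =
      ∑ i : Fin L, ∑ _a : Fin (d i.succ), ∑ _b : Fin (d i.castSucc), 2 * (reg / L) := by
    simp only [Finset.sum_const, Finset.card_univ, Fintype.card_fin, nsmul_eq_mul, numParams,
      Nat.cast_sum, Nat.cast_mul, Finset.mul_sum]
    refine Finset.sum_congr rfl fun i _ => ?_
    ring
  rw [Matrix.trace, Fintype.sum_sigma, h, ← Finset.sum_add_distrib]
  refine Finset.sum_congr rfl fun i _ => ?_
  simp only [Fintype.sum_prod_type, Matrix.diag_apply, hessian_loss_apply_self, mul_add,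
    Finset.sum_add_distrib, ← Finset.mul_sum, sum_frobenius_norm_mul_single_mul_sq]

theorem le_trace_hessian_loss (M : Matrix (Fin (d (Fin.last L))) (Fin (d 0)) ℝ) (reg : ℝ)
    {w : Params d} {g : ℝ} (hg : ∀ i, ‖layer w i‖ = g) :
    2 * (L : ℝ) * (‖endToEnd w‖ ^ 2 / g ^ 2) + 2 * reg / L * numParams d ≤
      (hessian (loss M reg) w).trace := by
  have h : ∀ i : Fin L, ‖endToEnd w‖ ^ 2 / g ^ 2 ≤
      ‖suffixProduct w i.succ‖ ^ 2 * ‖partialProduct w i.castSucc‖ ^ 2 := by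
    intro i
    -- This form of the division bound also covers `g = 0`, where the quotient is `0`.
    refine div_le_of_le_mul₀ (sq_nonneg _) (by positivity) ?_
    rw [← mul_pow, ← mul_pow]
    refine pow_le_pow_left₀ (norm_nonneg _) ?_ 2
    calc ‖endToEnd w‖
        ≤ ‖suffixProduct w i.succ‖ * (‖layer w i‖ * ‖partialProduct w i.castSucc‖) := by
          rw [← suffixProduct_mul_partialProduct w i.succ, partialProduct_succ]
          exact (frobenius_norm_mul _ _).trans
            (mul_le_mul_of_nonneg_left (frobenius_norm_mul _ _) (norm_nonneg _))
      _ = ‖suffixProduct w i.succ‖ * ‖partialProduct w i.castSucc‖ * g := by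
          rw [hg]
          ring
  rw [trace_hessian_loss]
  refine add_le_add_left ?_ _
  have := Finset.sum_le_sum fun i (_ : i ∈ Finset.univ) =>
    mul_le_mul_of_nonneg_left (h i) (zero_le_two (α := ℝ))
  refine le_trans (le_of_eq ?_) this
  simp only [Finset.sum_const, Finset.card_univ, Fintype.card_fin, nsmul_eq_mul]
  ring

end Hessian

end DeepMatrixFactorization

theorem mainTheorem6 (L : ℕ) (hL : 2 ≤ L) (d : Fin (L + 1) → ℕ)
    (hd : ∀ i : Fin (L + 1), min (d 0) (d (Fin.last L)) ≤ d i)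
    (reg : ℝ) (hreg : 0 < reg)
    (M : Matrix (Fin (d (Fin.last L))) (Fin (d 0)) ℝ)
    (hM : M ∉ DeepMatrixFactorization.exceptionalSet L reg (d (Fin.last L)) (d 0)) :
    (DeepMatrixFactorization.minimizers M reg).Nonempty ∧
    ∃ (P : Matrix (Fin (d (Fin.last L))) (Fin (d 0)) ℝ) (g : ℝ),
      ∀ w ∈ DeepMatrixFactorization.minimizers M reg,
        DeepMatrixFactorization.endToEnd w = P ∧
        (∀ i : Fin L, ‖DeepMatrixFactorization.layer w i‖ = g) ∧
        2 * (L : ℝ) * (‖P‖ ^ 2 / g ^ 2) +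
            2 * reg / (L : ℝ) * (DeepMatrixFactorization.numParams d : ℝ) ≤
          (DeepMatrixFactorization.hessian (DeepMatrixFactorization.loss M reg) w).trace := by
  have hL0 : (0 : ℝ) < L := by positivity
  have hne := DeepMatrixFactorization.minimizers_nonempty (M := M) (div_pos hreg hL0)
  obtain ⟨w₀, hw₀⟩ := hne
  refine ⟨⟨w₀, hw₀⟩, DeepMatrixFactorization.endToEnd w₀,
    ‖DeepMatrixFactorization.layer w₀ ⟨0, by omega⟩‖, fun w hw => ?_⟩
  have hP := DeepMatrixFactorization.endToEnd_eq_of_mem_minimizers hL hreg hd hM hw hw₀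
  have hg := fun i => DeepMatrixFactorization.norm_layer_eq_of_mem_minimizers hL hreg hd hM hw hw₀
    i ⟨0, by omega⟩
  refine ⟨hP, hg, ?_⟩
  rw [← hP]
  exact DeepMatrixFactorization.le_trace_hessian_loss M reg hg
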